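/- Regard the lattice $[0,1]$ (the closed unit interval of real numbers with its usual order) as a category, with exactly one morphism $a\to b$ if $a\le b$ and none otherwise. Then $[0,1]$ is accessible and predefinable, but it is not weakly definable. Here: - A category $\mathcal L$ is predefinable if it has all small products (including the empty one) and all colimits of small diagrams indexed by nonempty directed posets, and products distribute over directed colimits: for every small family of directed diagrams $\mathcal D_i\colon D_i\to\mathcal L$ $(i\in I)$ the canonical morphism $$\operatorname{colim}_{(d_i)\in\prod_{i\in I}D_i}\ \prod_{i\in I}\mathcal D_i(d_i)\ \longrightarrow\ \prod_{i\in I}\operatorname{colim}\mathcal D_i$$ is an isomorphism. - A category is weakly definable if it is equivalent to a full subcategory of some locally finitely presentable category $\mathcal K$ that is closed in $\mathcal K$ under small products (including the empty one) and directed colimits. -/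

import Mathlib

open CategoryTheory CategoryTheory.Limits

universe w v u v₁ u₁

namespace DefinableCategories

/-- A category `C` has directed colimits if it has colimits of all diagrams indexed by
(`w`-small, nonempty) directed posets. -/
class HasDirectedColimits (C : Type u) [Category.{v} C] : Prop where
  hasColimitsOfShape (J : Type w) [PartialOrder J] [IsDirectedOrder J] [Nonempty J] :
    HasColimitsOfShape J C

/-- The product of a family of posets, with the componentwise order. This is a copy of
`∀ i, J i`, which itself carries the product category structure `CategoryTheory.pi`. -/
def PiPoset {I : Type w} (J : I → Type w) : Type w := ∀ i, J i

instance {I : Type w} (J : I → Type w) [∀ i, PartialOrder (J i)] : PartialOrder (PiPoset J) :=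
  inferInstanceAs (PartialOrder (∀ i, J i))

/-- A product of directed posets, as a category, is the category of a directed poset, so
the colimit of a "product diagram" exists in any category with directed colimits. -/
theorem hasColimitsOfShape_pi (C : Type u) [Category.{v} C] [HasDirectedColimits.{w} C]
    {I : Type w} (J : I → Type w) [∀ i, PartialOrder (J i)] [∀ i, IsDirectedOrder (J i)]
    [∀ i, Nonempty (J i)] :
    HasColimitsOfShape (∀ i, J i) C := by
  have : IsDirectedOrder (PiPoset J) := ⟨fun a b => by
    choose f hf using fun i => exists_ge_ge (a i) (b i)
    exact ⟨f, fun i => (hf i).1, fun i => (hf i).2⟩⟩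
  have : Nonempty (PiPoset J) := inferInstanceAs (Nonempty (∀ i, J i))
  have h := HasDirectedColimits.hasColimitsOfShape (C := C) (PiPoset J)
  let F : PiPoset J ⥤ ∀ i, J i :=
    { obj := fun x => x
      map := fun f i => homOfLE (leOfHom f i)
      map_id := fun _ => by funext i; exact Subsingleton.elim _ _
      map_comp := fun _ _ => by funext i; exact Subsingleton.elim _ _ }
  have hF : F.Full := ⟨fun g =>
    ⟨homOfLE fun i => leOfHom (g i), by funext i; exact Subsingleton.elim _ _⟩⟩
  have hF' : F.Faithful := ⟨fun _ => Subsingleton.elim _ _⟩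
  have hF'' : F.EssSurj := ⟨fun y => ⟨y, ⟨Iso.refl _⟩⟩⟩
  have : F.IsEquivalence := { }
  exact hasColimitsOfShape_of_equivalence F.asEquivalence

/-- A category is predefinable if it has (small) products and directed colimits and products
distribute over directed colimits: for every small family `F i : J i ⥤ C` of directed diagrams,
with product diagram `pointwiseProduct F : (∀ i, J i) ⥤ C`, `(d i) ↦ ∏ᶜ fun i => (F i).obj (d i)`,
the canonical morphism `colim (pointwiseProduct F) ⟶ ∏ᶜ fun i => colim (F i)` is an
isomorphism. -/
structure IsPredefinable (C : Type u) [Category.{v} C] : Prop where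
  hasProducts : HasProducts.{w} C
  hasDirectedColimits : HasDirectedColimits.{w} C
  isIso_canonicalMorphism (I : Type w) (J : I → Type w) [∀ i, PartialOrder (J i)]
    [∀ i, IsDirectedOrder (J i)] [∀ i, Nonempty (J i)] (F : ∀ i, J i ⥤ C) :
    haveI : ∀ i, HasColimitsOfShape (J i) C := fun i =>
      HasDirectedColimits.hasColimitsOfShape (J i)
    haveI : HasColimitsOfShape (∀ i, J i) C := hasColimitsOfShape_pi C J
    IsIso (colimitPointwiseProductToProductColimit F)

/-- A full subcategory (given by the property `P` of its objects) of a category `K` is closed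
under (small) products, including the empty product, and under directed colimits, both formed
in `K`. Applied to a locally finitely presentable `K`, this says that the full subcategory is
weakly definable. -/
structure IsClosedUnderProductsAndDirectedColimits {K : Type u} [Category.{v} K]
    (P : ObjectProperty K) : Prop where
  products (I : Type w) : P.IsClosedUnderLimitsOfShape (Discrete I)
  directedColimits (J : Type w) [PartialOrder J] [IsDirectedOrder J] [Nonempty J] :
    P.IsClosedUnderColimitsOfShape J

/-- A category `C` is weakly definable if it is equivalent to a full subcategory of a locally
finitely presentable category `K` which is closed in `K` under products and directed colimits. -/
def IsWeaklyDefinable (C : Type u₁) [Category.{v₁} C] : Prop :=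
  ∃ (K : Type u) (_ : Category.{v} K) (P : ObjectProperty K),
    IsLocallyFinitelyPresentable.{w} K ∧
    IsClosedUnderProductsAndDirectedColimits.{w} P ∧
    Nonempty (C ≌ P.FullSubcategory)

end DefinableCategories

open Opposite

/-! If `[0,1]` embeds in `K` by `G` preserving products and directed colimits, take `A` finitely
presentable. The set of `x` with a morphism `A ⟶ G.obj x` is closed under infima, so it has a least
element. That element is `0`: any `x > 0` is the directed supremum of the `y < x`, so a morphism to
`G.obj x` factors through a smaller stage. As `x = x × x`, such morphisms are also unique. So
finitely presentable objects, which form a strong generator, cannot separate `G.obj 0` from `G.obj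
1`, and `0 = 1`. Predefinability is complete distributivity; accessibility holds with any regular
`κ` above the cardinality of the lattice. -/

section Preliminaries

variable {K : Type u} [Category.{v} K]

/-- A cocomplete category with a dense functor from a small category is complete, because it is
reflective in a category of presheaves. -/
theorem hasLimitsOfSize_of_isDense {D : Type w} [SmallCategory D] {E : Type u} [Category.{w} E]
    [HasColimitsOfSize.{w, w} E] (A : D ⥤ E) [A.IsDense] : HasLimitsOfSize.{w, w} E := by
  have (X : Dᵒᵖ ⥤ Type w) :
      HasColimitsOfShape (CostructuredArrow (uliftYoneda.{w} (C := D)) X) E :=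
    hasColimitsOfShape_of_equivalence (equivSmallModel.{w} _).symm
  have : (uliftYoneda.{w} (C := D)).HasPointwiseLeftKanExtension A := fun X => by
    unfold Functor.HasPointwiseLeftKanExtensionAt
    infer_instance
  -- Density of `A` makes `R` fully faithful; its left adjoint is the left Kan extension of `A`
  -- along Yoneda.
  let R : E ⥤ Dᵒᵖ ⥤ Type w := Presheaf.restrictedULiftYoneda.{w} A
  let : Reflective R :=
    { L := _
      adj := Presheaf.uliftYonedaAdjunction.{w} _
        ((uliftYoneda.{w} (C := D)).leftKanExtensionUnit A) }
  exact hasLimits_of_reflective R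

/-- A locally presentable category is complete. -/
theorem hasLimitsOfSize_of_isCardinalLocallyPresentable (κ : Cardinal.{w}) [Fact κ.IsRegular]
    [IsCardinalLocallyPresentable K κ] : HasLimitsOfSize.{w, w} K := by
  let P := isCardinalPresentable K κ
  -- Shrinking the hom-sets of `K` to `Type w` lets the presheaves take values there.
  let A := (equivSmallModel.{w} P.FullSubcategory).inverse ⋙ P.ι ⋙ ShrinkHoms.functor.{w} K
  have : HasColimitsOfSize.{w, w} (ShrinkHoms.{u} K) :=
    Adjunction.has_colimits_of_equivalence (ShrinkHoms.inverse.{w} K)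
  have := hasLimitsOfSize_of_isDense A
  exact Adjunction.has_limits_of_equivalence (ShrinkHoms.functor.{w} K)

end Preliminaries

section CompleteLattice

/-- In a poset with fewer than `κ` elements, a `κ`-filtered diagram is eventually constant. -/
theorem exists_isEventuallyConstantFrom {α : Type u} [PartialOrder α] {κ : Cardinal.{w}}
    [Fact κ.IsRegular] (hα : HasCardinalLT α κ) {J : Type w} [SmallCategory J]
    [IsCardinalFiltered J κ] (F : J ⥤ α) : ∃ j, F.IsEventuallyConstantFrom j := by
  have hR : HasCardinalLT (Set.range F.obj) κ :=
    hα.of_injective _ Subtype.val_injective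
  let s : Set.range F.obj → J := fun y => y.2.choose
  have hs (y : Set.range F.obj) : F.obj (s y) = y := y.2.choose_spec
  -- The fewer than `κ` values of `F` have chosen preimages `s`; at an upper bound of these, `F` has
  -- reached its greatest value.
  refine ⟨IsCardinalFiltered.max s hR, fun j f => ?_⟩
  have h : F.obj j ≤ F.obj (IsCardinalFiltered.max s hR) := by
    exact (hs ⟨F.obj j, j, rfl⟩).ge.trans (leOfHom (F.map (IsCardinalFiltered.toMax s hR _)))
  exact ⟨homOfLE h, Subsingleton.elim _ _, Subsingleton.elim _ _⟩

/-- In a poset with fewer than `κ` elements, all objects are `κ`-presentable. -/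
theorem isCardinalPresentable_of_hasCardinalLT {α : Type u} [PartialOrder α] {κ : Cardinal.{w}}
    [Fact κ.IsRegular] (hα : HasCardinalLT α κ) (x : α) : IsCardinalPresentable x κ where
  preservesColimitOfShape J _ _ :=
    { preservesColimit {F} :=
        { preserves {c} hc := ⟨by
            have := isFiltered_of_isCardinalFiltered J κ
            have h := exists_isEventuallyConstantFrom hα F
            have hi := h.choose_spec.isIso_ι_of_isColimit hc
            have hG : (F ⋙ coyoneda.obj (op x)).IsEventuallyConstantFrom h.choose :=
              fun j f => by
                have := h.choose_spec f
                exact inferInstanceAs (IsIso ((coyoneda.obj (op x)).map (F.map f)))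
            have : IsIso (((coyoneda.obj (op x)).mapCocone c).ι.app h.choose) :=
              inferInstanceAs (IsIso ((coyoneda.obj (op x)).map (c.ι.app h.choose)))
            exact hG.isColimitOfIsIso _⟩ } }

/-- A complete lattice is an accessible category. -/
theorem isAccessibleCategory_of_completeLattice {α : Type} [CompleteLattice α] :
    IsAccessibleCategory.{w} α := by
  obtain ⟨κ, hκ, hα⟩ := HasCardinalLT.exists_regular_cardinal.{w} α
  have : Fact κ.IsRegular := ⟨hκ⟩
  have : EssentiallySmall.{w} α := essentiallySmall_of_small_of_locallySmall _
  have hP : (⊤ : ObjectProperty α).IsCardinalFilteredGenerator κ :=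
    { le_isCardinalPresentable := fun x _ => isCardinalPresentable_of_hasCardinalLT hα x
      -- Every object is presentable, so each is the colimit of the one-point diagram on itself.
      exists_colimitsOfShape := fun x =>
        ⟨Discrete PUnit, inferInstance, isCardinalFiltered_of_hasTerminal _ _,
          ⟨{ diag := (Functor.const _).obj x
             ι := 𝟙 _
             isColimit :=
              { desc := fun s => s.ι.app ⟨⟨⟩⟩
                fac := fun _ _ => Subsingleton.elim _ _
                uniq := fun _ _ _ => Subsingleton.elim _ _ }
             prop_diag_obj := fun _ => trivial }⟩⟩ }
  exact ⟨κ, ⟨hκ⟩, { toHasCardinalFilteredGenerator := hP.hasCardinalFilteredGenerator }⟩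

end CompleteLattice

/-- A completely distributive lattice is a predefinable category. -/
theorem isPredefinable_of_completelyDistribLattice {α : Type u} [CompletelyDistribLattice α] :
    DefinableCategories.IsPredefinable.{w} α where
  hasProducts _ := inferInstance
  hasDirectedColimits := ⟨fun _ _ _ _ => inferInstance⟩
  isIso_canonicalMorphism I J _ _ _ F := by
    -- In a poset, the canonical morphism is invertible once the reverse inequality holds.
    have h : (∏ᶜ fun i => colimit (F i)) ≤ colimit (pointwiseProduct F) := by
      calc (∏ᶜ fun i => colimit (F i)) ≤ ⨅ i, ⨆ j, (F i).obj j :=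
            le_iInf fun i => (leOfHom (Pi.π _ i)).trans
              (CompleteLattice.colimit_eq_iSup (F i)).le
        _ = ⨆ d : ∀ i, J i, ⨅ i, (F i).obj (d i) := iInf_iSup_eq
        _ ≤ colimit (pointwiseProduct F) := iSup_le fun d =>
            (leOfHom (Pi.lift fun i => homOfLE (iInf_le _ i))).trans
              (leOfHom (colimit.ι (pointwiseProduct F) d))
    exact ⟨homOfLE h, Subsingleton.elim _ _, Subsingleton.elim _ _⟩

section WeaklyDefinable

variable {α : Type} {K : Type u} [Category.{v} K]

/-- If `G` preserves products, there is at most one morphism `A ⟶ G.obj x`, as `x = x × x`. -/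
theorem subsingleton_hom_of_preservesLimits [PartialOrder α] (G : α ⥤ K)
    [PreservesLimitsOfShape (Discrete (ULift.{w} Bool)) G] (A : K) (x : α) :
    Subsingleton (A ⟶ G.obj x) := by
  refine ⟨fun f g => ?_⟩
  let c : Fan fun _ : ULift.{w} Bool => x := Fan.mk x fun _ => 𝟙 x
  have hc : IsLimit c :=
    { lift := fun s => s.π.app ⟨⟨true⟩⟩
      fac := fun _ _ => Subsingleton.elim _ _
      uniq := fun _ _ _ => Subsingleton.elim _ _ }
  -- Both projections of `x × x = x` are identities, so the lift of the pair `(f, g)` equals both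
  -- `f` and `g`.
  let s : Cone (Discrete.functor (fun _ : ULift.{w} Bool => x) ⋙ G) :=
    { pt := A
      π := Discrete.natTrans fun b => bif b.as.down then f else g }
  have hG := isLimitOfPreserves G hc
  have h (b) := hG.fac s ⟨⟨b⟩⟩
  have hf := h true
  have hg := h false
  simp only [c, s, Functor.mapCone_π_app, Fan.mk_π_app] at hf hg
  exact (hf.symm.trans rfl).trans hg

/-- If `G` preserves products, the set of `x` with a morphism `A ⟶ G.obj x` is closed under
infima. -/
theorem nonempty_hom_sInf [CompleteLattice α] (G : α ⥤ K)
    [∀ I : Type w, PreservesLimitsOfShape (Discrete I) G] (A : K) (S : Set α)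
    (hS : ∀ x ∈ S, Nonempty (A ⟶ G.obj x)) : Nonempty (A ⟶ G.obj (sInf S)) := by
  let F := Discrete.functor fun x : ULift.{w} S => x.down.1
  let c : Cone F :=
    { pt := sInf S
      π := Discrete.natTrans fun x => homOfLE (sInf_le x.as.down.2) }
  have hc : IsLimit c :=
    { lift := fun s => homOfLE (le_sInf fun x hx => leOfHom (s.π.app ⟨⟨⟨x, hx⟩⟩⟩))
      fac := fun _ _ => Subsingleton.elim _ _
      uniq := fun _ _ _ => Subsingleton.elim _ _ }
  exact ⟨(isLimitOfPreserves G hc).lift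
    { pt := A
      π := Discrete.natTrans fun x => (hS _ x.as.down.2).some }⟩

/-- If `G` preserves directed colimits and `A` is finitely presentable, a morphism `A ⟶ G.obj x`
with `x` not minimal factors through `G.obj y` for some `y < x`. -/
theorem exists_lt_nonempty_hom [LinearOrder α] [DenselyOrdered α] (G : α ⥤ K)
    (hG : ∀ (J : Type w) [PartialOrder J] [IsDirectedOrder J] [Nonempty J],
      PreservesColimitsOfShape J G)
    (A : K) [IsFinitelyPresentable.{w} A] {x z : α} (hz : z < x) (f : A ⟶ G.obj x) :
    ∃ y < x, Nonempty (A ⟶ G.obj y) := by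
  let J := ULift.{w} (Set.Iio x)
  have : Nonempty J := ⟨⟨⟨z, hz⟩⟩⟩
  have := hG J
  let F : J ⥤ α := Monotone.functor (f := fun y => y.down.1) fun _ _ h => h
  let c : Cocone F :=
    { pt := x
      ι := { app := fun y => homOfLE (le_of_lt y.down.2) } }
  have hc : IsColimit c :=
    { desc := fun s => homOfLE (le_of_forall_lt_imp_le_of_dense fun y hy =>
        leOfHom (s.ι.app ⟨⟨y, hy⟩⟩))
      fac := fun _ _ => Subsingleton.elim _ _
      uniq := fun _ _ _ => Subsingleton.elim _ _ }
  obtain ⟨y, p, -⟩ := IsFinitelyPresentable.exists_hom_of_isColimit (isColimitOfPreserves G hc) f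
  exact ⟨y.down.1, y.down.2, ⟨p⟩⟩

/-- A nontrivial densely ordered complete linear order is not weakly definable. -/
theorem not_isWeaklyDefinable_of_completeLinearOrder [CompleteLinearOrder α] [DenselyOrdered α]
    [Nontrivial α] : ¬ DefinableCategories.IsWeaklyDefinable.{w, v, u} α := by
  rintro ⟨K, _, P, _, hP, ⟨e⟩⟩
  have : Fact (Cardinal.aleph0.{w}).IsRegular := Cardinal.fact_isRegular_aleph0
  have : IsCardinalLocallyPresentable K Cardinal.aleph0.{w} := ‹_›
  -- Products exist in `K`, so the inclusion of `P`, closed under them, preserves them.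
  have := hasLimitsOfSize_of_isCardinalLocallyPresentable (K := K) Cardinal.aleph0.{w}
  let G := e.functor ⋙ P.ι
  have (I : Type w) : PreservesLimitsOfShape (Discrete I) G := by
    have := hP.products I
    infer_instance
  have hG (J : Type w) [PartialOrder J] [IsDirectedOrder J] [Nonempty J] :
      PreservesColimitsOfShape J G := by
    have := hP.directedColimits J
    infer_instance
  have hne (A : K) [IsFinitelyPresentable.{w} A] : Nonempty (A ⟶ G.obj ⊥) := by
    let S := {x | Nonempty (A ⟶ G.obj x)}
    obtain ⟨f⟩ := nonempty_hom_sInf G A S fun _ hx => hx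
    rcases eq_bot_or_bot_lt (sInf S) with h | h
    · exact ⟨h ▸ f⟩
    · obtain ⟨y, hy, hy'⟩ := exists_lt_nonempty_hom G hG A h f
      exact absurd (sInf_le (show y ∈ S from hy')) hy.not_ge
  obtain ⟨Q, _, hQ⟩ := HasCardinalFilteredGenerator.exists_generator K Cardinal.aleph0.{w}
  let i : (⊥ : α) ⟶ ⊤ := homOfLE bot_le
  have hs (A : K) (x : α) := subsingleton_hom_of_preservesLimits.{w} G A x
  have : Mono (G.map i) := ⟨fun _ _ _ => Subsingleton.elim _ _⟩
  -- A monomorphism through which every morphism from a strong generator factors is invertible.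
  have : IsIso (G.map i) := hQ.isStrongGenerator.isIso_of_mono _ fun A hA f => by
    have : IsFinitelyPresentable.{w} A := hQ.le_isCardinalPresentable A hA
    exact ⟨(hne A).some, Subsingleton.elim _ _⟩
  have := isIso_of_reflects_iso i G
  exact bot_ne_top (α := α) (le_antisymm bot_le (leOfHom (inv i)))

end WeaklyDefinable

theorem mainTheorem12 :
    IsAccessibleCategory.{w} (Set.Icc (0 : ℝ) 1) ∧
    DefinableCategories.IsPredefinable.{w} (Set.Icc (0 : ℝ) 1) ∧
    ¬ DefinableCategories.IsWeaklyDefinable.{w, v, u} (Set.Icc (0 : ℝ) 1) :=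
  ⟨isAccessibleCategory_of_completeLattice, isPredefinable_of_completelyDistribLattice,
    not_isWeaklyDefinable_of_completeLinearOrder⟩
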